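/- A pushdown automaton (PDA) consists of finite sets of states, of input letters and of stack symbols, an initial state, an initial stack symbol, a set of final states, and finitely many moves $(q,a,Z,q',\gamma)$, where $a$ is an input letter or $a=\varepsilon$: in state $q$ with topmost stack symbol $Z$, the automaton reads $a$, enters the state $q'$ and replaces $Z$ by the word $\gamma$ of stack symbols. It accepts a word if some computation that starts in the initial state, with the stack holding only the initial stack symbol, reads the whole word and ends in a final state. A PDA is deterministic if for all $q$ and $Z$ there is at most one move for each $a$ and if, whenever there is a move with $a=\varepsilon$, it is the only move for $q$ and $Z$. It is linear if each of its computations on any input makes at most one reversal on the stack, from increasing to decreasing mode: after a step that lowers the height of the stack, no later step raises it. A deterministic linear context-free language is a language accepted by a deterministic linear PDA. **Theorem 4.1.** It is undecidable for deterministic linear context-free languages $L$, given by deterministic linear PDAs, whether $ww\in L$ for some word $w$. That is, there is no algorithm which, for every deterministic linear PDA $M$ given as input, halts and answers correctly whether there is a word $w$ such that $M$ accepts $ww$. -/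

import Mathlib

/-- A move of a pushdown automaton. In state `source`, with `top` the topmost stack symbol, the
automaton reads the letter `a` if `label = some a`, and reads nothing if `label = none` (an
`ε`-move). It then enters the state `target` and replaces the topmost stack symbol by the word
`push`, whose first symbol becomes the topmost one. -/
structure PDAMove where
  source : ℕ
  label : Option ℕ
  top : ℕ
  target : ℕ
  push : List ℕ

/-- A (nondeterministic) pushdown automaton, as a finite object. States, input letters and stack
symbols are named by natural numbers. The sets of states, of letters and of stack symbols are
finite, because only the names that occur in the finite lists below are ever used; up to renaming,
every pushdown automaton has this form. -/
structure PDA where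
  start : ℕ
  bottom : ℕ
  final : List ℕ
  moves : List PDAMove

/-- A move is the tuple of its components. -/
def PDAMove.equivProd : PDAMove ≃ ℕ × Option ℕ × ℕ × ℕ × List ℕ where
  toFun t := (t.source, t.label, t.top, t.target, t.push)
  invFun x := ⟨x.1, x.2.1, x.2.2.1, x.2.2.2.1, x.2.2.2.2⟩
  left_inv _ := rfl
  right_inv _ := rfl

instance PDAMove.instPrimcodable : Primcodable PDAMove :=
  Primcodable.ofEquiv (ℕ × Option ℕ × ℕ × ℕ × List ℕ) PDAMove.equivProd

/-- A pushdown automaton is the tuple of its components. -/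
def PDA.equivProd : PDA ≃ ℕ × ℕ × List ℕ × List PDAMove where
  toFun M := (M.start, M.bottom, M.final, M.moves)
  invFun x := ⟨x.1, x.2.1, x.2.2.1, x.2.2.2⟩
  left_inv _ := rfl
  right_inv _ := rfl

/-- The standard encoding of pushdown automata, which makes them inputs of algorithms. -/
instance PDA.instPrimcodable : Primcodable PDA :=
  Primcodable.ofEquiv (ℕ × ℕ × List ℕ × List PDAMove) PDA.equivProd

/-- A configuration: the state, the input not yet read, and the stack (topmost symbol first). -/
structure PDAConfig where
  state : ℕ
  input : List ℕ
  stack : List ℕ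

namespace PDA

/-- One step of a computation. -/
inductive Step (M : PDA) : PDAConfig → PDAConfig → Prop
  | move (t : PDAMove) (ht : t ∈ M.moves) (w s : List ℕ) :
      Step M ⟨t.source, t.label.toList ++ w, t.top :: s⟩ ⟨t.target, w, t.push ++ s⟩

/-- Finitely many (possibly zero) steps of a computation. -/
def Reaches (M : PDA) : PDAConfig → PDAConfig → Prop :=
  Relation.ReflTransGen M.Step

/-- The initial configuration on the input `w`. -/
def init (M : PDA) (w : List ℕ) : PDAConfig :=
  ⟨M.start, w, [M.bottom]⟩

/-- The language accepted by final state: some computation reads the whole input and ends in a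
final state. -/
def language (M : PDA) : Language ℕ :=
  {w | ∃ q ∈ M.final, ∃ s : List ℕ, M.Reaches (M.init w) ⟨q, [], s⟩}

/-- Determinism: for every state and topmost stack symbol there is at most one move for each input
letter and at most one `ε`-move, and if there is an `ε`-move, then there is no other move. -/
def IsDeterministic (M : PDA) : Prop :=
  ∀ t₁ ∈ M.moves, ∀ t₂ ∈ M.moves, t₁.source = t₂.source → t₁.top = t₂.top →
    (t₁.label = none ∨ t₁.label = t₂.label) → t₁ = t₂

/-- Linearity: every computation makes at most one reversal on the stack, from increasing to
decreasing mode. That is, after a step that lowers the stack no later step raises it. -/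
def IsLinear (M : PDA) : Prop :=
  ∀ (w : List ℕ) (c₁ c₂ c₃ c₄ : PDAConfig), M.Reaches (M.init w) c₁ →
    M.Step c₁ c₂ → c₂.stack.length < c₁.stack.length →
    M.Reaches c₂ c₃ → M.Step c₃ c₄ → c₄.stack.length ≤ c₃.stack.length

end PDA

/-! Halting of a suitable fixed Turing machine on the inputs `a b c ⋯ c` is reduced to the question.
A Turing machine is simulated by a queue machine whose queue holds the tape cyclically. Since a
queue is read in the order in which it is written, a computation is described by the single word `u`
of all letters that ever enter the queue: with initial queue `w`, it satisfies the fixed-point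
equation `u = w ++ output u`. The machine halts exactly if some `u` solves this equation and leads
to an accepting state (`Turing.TM0.eval_dom_iff_exists_isHistory`).

A deterministic linear automaton cannot test the equation, but it accepts the words `u # y $ yᴿ # (w
++ output u)ᴿ $` for which `u` leads to acceptance: it pushes `w`, `output u`, `#` and `y`, and
afterwards only pops. If such a word is a square `xx`, its two letters `$` force `x = u # y $` and
`u # y = yᴿ # (w ++ output u)ᴿ`. Hence `u = yᴿ` and `y = (w ++ output u)ᴿ`, which is the equation.
Conversely, a solution `u` gives `x = u # uᴿ $`. These are
`QueueMachine.exists_isHistory_of_mem_language` and `QueueMachine.mem_language_of_isHistory`. -/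

/-! ### Undecidable halting for a fixed finite Turing machine -/

/-- The binary encoding of `2 ^ k` used by Mathlib's stack machines. -/
theorem Turing.PartrecToTM2.trNat_two_pow (k : ℕ) :
    Turing.PartrecToTM2.trNat (2 ^ k) =
      List.replicate k Turing.PartrecToTM2.Γ'.bit0 ++ [Turing.PartrecToTM2.Γ'.bit1] := by
  have h : ∀ k : ℕ, ∃ p : PosNum, ((2 ^ k : ℕ) : Num) = Num.pos p ∧
      Turing.PartrecToTM2.trPosNum p =
      List.replicate k Turing.PartrecToTM2.Γ'.bit0 ++ [Turing.PartrecToTM2.Γ'.bit1] := by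
    intro k
    induction k with
    | zero => exact ⟨1, by simp; rfl, rfl⟩
    | succ k ih =>
      obtain ⟨p, hp, hp'⟩ := ih
      refine ⟨p.bit0, ?_, ?_⟩
      · rw [pow_succ, mul_two, Nat.cast_add, hp]
        exact (Num.bit0_of_bit0 (Num.pos p))
      · simp [Turing.PartrecToTM2.trPosNum, hp', List.replicate_succ]
  obtain ⟨p, hp, hp'⟩ := h k
  rw [Turing.PartrecToTM2.trNat, hp]
  exact hp'

theorem Primrec.two_pow : Primrec fun k : ℕ => 2 ^ k :=
  (Primrec.nat_rec₁ 1 (Primrec.nat_add.comp Primrec.snd Primrec.snd).to₂).of_eq fun k => by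
    induction k with
    | zero => rfl
    | succ k ih => simp_all [pow_succ, mul_two]

/-- There is a partial recursive function whose domain is undecidable on the powers of two. -/
theorem exists_partrec_not_computablePred_two_pow :
    ∃ F : ℕ →. ℕ, Partrec F ∧ ¬ ComputablePred fun k : ℕ => (F (2 ^ k)).Dom := by
  have hlog : Partrec fun m : ℕ => Nat.rfind fun k => Part.some (decide (2 ^ k = m)) := by
    refine Partrec.rfind (Computable.partrec ?_)
    have h : PrimrecPred fun x : ℕ × ℕ => 2 ^ x.2 = x.1 :=
      Primrec.eq.comp (Primrec.two_pow.comp Primrec.snd) Primrec.fst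
    exact h.decide.to_comp
  -- The search recovers `k` from `2 ^ k`. Powers of two are used because their binary expansions
  -- have the uniform shape `0 ⋯ 0 1`.
  refine ⟨fun m => (Nat.rfind fun k => Part.some (decide (2 ^ k = m))).bind fun k =>
    (Denumerable.ofNat Nat.Partrec.Code k).eval 0, ?_, ?_⟩
  · refine hlog.bind ?_
    exact Nat.Partrec.Code.eval_part.comp ((Computable.ofNat _).comp Computable.snd)
      (Computable.const 0)
  · intro h
    refine ComputablePred.halting_problem 0 ?_
    have key : ∀ k, (Nat.rfind fun j => Part.some (decide (2 ^ j = 2 ^ k))) = Part.some k := by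
      intro k
      refine Part.eq_some_iff.2 (Nat.mem_rfind.2 ⟨?_, fun {m} hm => ?_⟩)
      · simp
      · simp [hm.ne]
    have h' : ComputablePred fun k : ℕ => ((Denumerable.ofNat Nat.Partrec.Code k).eval 0).Dom := by
      simpa only [key, Part.bind_some] using h
    obtain ⟨f, hf, hfe⟩ := ComputablePred.computable_iff.1 h'
    refine ComputablePred.computable_iff.2
      ⟨fun c => f (Encodable.encode c), hf.comp Computable.encode, ?_⟩
    funext c
    have := congrFun hfe (Encodable.encode c)
    simpa using this

open Turing in
/-- A finite Turing machine with undecidable halting problem, on inputs of the form `a b c ⋯ c`. -/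
theorem exists_finite_TM0_not_computablePred :
    ∃ (Γ Λ : Type) (_ : Inhabited Γ) (_ : Inhabited Λ) (_ : Finite Γ) (_ : Finite Λ)
      (M : TM0.Machine Γ Λ) (a b c : Γ),
      ¬ ComputablePred fun k : ℕ => (TM0.eval M (a :: b :: List.replicate k c)).Dom := by
  obtain ⟨F, hF, hund⟩ := exists_partrec_not_computablePred_two_pow
  obtain ⟨c, hc⟩ := ToPartrec.Code.exists_code (Nat.Partrec'.part_iff₁.2 hF)
  let i : Inhabited PartrecToTM2.Λ' := ⟨PartrecToTM2.trNormal c PartrecToTM2.Cont'.halt⟩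
  let M₁ := TM2to1.tr (K := PartrecToTM2.K') PartrecToTM2.tr
  have hsupp₁ := TM2to1.tr_supports _ (PartrecToTM2.tr_supports c PartrecToTM2.Cont'.halt)
  have hsupp := TM1to0.tr_supports M₁ hsupp₁
  -- The compiled machine has an infinite type of states, but only those in the finite support `S`
  -- occur. States outside `S` are sent to the default one, which does not affect the run.
  let S : Finset (TM1to0.Λ' M₁) := TM1to0.trStmts M₁
    (TM2to1.trSupp PartrecToTM2.tr (PartrecToTM2.codeSupp c PartrecToTM2.Cont'.halt))
  let iS : Inhabited S := ⟨⟨default, hsupp.1⟩⟩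
  classical
  let g₁ : PointedMap (TM1to0.Λ' M₁) S :=
    ⟨fun q => if h : q ∈ S then ⟨q, h⟩ else default, by
      have : default ∈ S := hsupp.1
      simp only [this, dif_pos]; rfl⟩
  let e : PointedMap (TM2to1.Γ' PartrecToTM2.K' fun _ => PartrecToTM2.Γ')
    (TM2to1.Γ' PartrecToTM2.K' fun _ => PartrecToTM2.Γ') := ⟨id, rfl⟩
  have hresp := TM0.Machine.map_respects (TM1to0.tr M₁) e e g₁ Subtype.val hsupp
    (fun _ => rfl) (fun q hq => by
      have : q ∈ S := hq
      simp [g₁, this])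
  -- A tape cell holds one layer of all four stacks; initially only the main stack is nonempty. The
  -- flag `d` marks the bottom cell.
  let u (d : Bool) (x : PartrecToTM2.Γ') : TM2to1.Γ' PartrecToTM2.K' fun _ => PartrecToTM2.Γ' :=
    (d, Function.update (fun _ => none) PartrecToTM2.K'.main (some x))
  have : Finite PartrecToTM2.K' := by
    refine Set.finite_univ_iff.1 ((Set.toFinite {PartrecToTM2.K'.main, PartrecToTM2.K'.rev,
      PartrecToTM2.K'.aux, PartrecToTM2.K'.stack}).subset fun x _ => ?_)
    cases x <;> simp
  refine ⟨TM2to1.Γ' PartrecToTM2.K' fun _ => PartrecToTM2.Γ', S, inferInstance, iS,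
    inferInstanceAs (Finite (Bool × (PartrecToTM2.K' → Option PartrecToTM2.Γ'))),
    inferInstance, TM0.Machine.map (TM1to0.tr M₁) e e g₁ Subtype.val,
    u true PartrecToTM2.Γ'.cons, u false PartrecToTM2.Γ'.bit1,
    u false PartrecToTM2.Γ'.bit0, ?_⟩
  · refine fun h => hund (h.of_eq fun k => ?_)
    have hw : u true PartrecToTM2.Γ'.cons :: u false PartrecToTM2.Γ'.bit1 ::
        List.replicate k (u false PartrecToTM2.Γ'.bit0) =
        TM2to1.trInit (K := PartrecToTM2.K') (Γ := fun _ => PartrecToTM2.Γ')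
          PartrecToTM2.K'.main (PartrecToTM2.trList [2 ^ k]) := by
      have hrev : (PartrecToTM2.trList [2 ^ k]).reverse = PartrecToTM2.Γ'.cons ::
          PartrecToTM2.Γ'.bit1 :: List.replicate k PartrecToTM2.Γ'.bit0 := by
        simp [PartrecToTM2.trList, PartrecToTM2.trNat_two_pow]
      have htr : TM2to1.trInit (K := PartrecToTM2.K') (Γ := fun _ => PartrecToTM2.Γ')
          PartrecToTM2.K'.main (PartrecToTM2.trList [2 ^ k]) =
          (true, ((PartrecToTM2.trList [2 ^ k]).reverse.map (u false)).headI.2) ::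
            ((PartrecToTM2.trList [2 ^ k]).reverse.map (u false)).tail := rfl
      rw [htr, hrev, List.map_cons, List.map_cons, List.map_replicate]
      rfl
    rw [hw]
    generalize hl : TM2to1.trInit (K := PartrecToTM2.K') (Γ := fun _ => PartrecToTM2.Γ')
      PartrecToTM2.K'.main (PartrecToTM2.trList [2 ^ k]) = l
    have h₀ : (TM0.eval (TM0.Machine.map (TM1to0.tr M₁) e e g₁ Subtype.val) l).Dom ↔
        (TM0.eval (TM1to0.tr M₁) l).Dom := by
      refine StateTransition.tr_eval_dom hresp ⟨hsupp.1, ?_⟩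
      rw [TM0.map_init]
      congr
      exact List.map_id l
    rw [h₀, TM1to0.tr_eval, ← hl]
    refine (TM2to1.tr_eval_dom _ _ _).trans ?_
    have h₁ : TM2.init (Λ := PartrecToTM2.Λ') (σ := Option PartrecToTM2.Γ')
        PartrecToTM2.K'.main (PartrecToTM2.trList [2 ^ k]) = PartrecToTM2.init c [2 ^ k] := by
      simp only [TM2.init, PartrecToTM2.init]
      congr
      funext x
      cases x <;> rfl
    have h₂ := PartrecToTM2.tr_eval c [2 ^ k]
    have h₃ := hc (2 ^ k ::ᵥ List.Vector.nil)
    change c.eval [2 ^ k] = _ at h₃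
    change (StateTransition.eval _ (TM2.init _ _)).Dom ↔ _
    rw [h₁, h₂, h₃]
    rfl

/-! ### Queue machines and their histories -/

/-- A queue machine: it reads the first letter of a queue and appends a word to its end. Accepting
states read the remaining queue without changing the state or appending anything. -/
structure QueueMachine (σ α : Type) where
  trans : σ → α → σ × List α
  accept : σ → Bool
  trans_of_accept : ∀ s x, accept s = true → trans s x = (s, [])

namespace QueueMachine

variable {σ α : Type} (Q : QueueMachine σ α)

/-- One step; the machine halts in accepting states and on the empty queue. -/
def step : σ × List α → Option (σ × List α)
  | (_, []) => none
  | (s, x :: w) => if Q.accept s then none else some ((Q.trans s x).1, w ++ (Q.trans s x).2)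

/-- The state reached after reading a word. -/
def run : σ → List α → σ
  | s, [] => s
  | s, x :: u => run (Q.trans s x).1 u

/-- The word appended to the queue while reading a word. -/
def output : σ → List α → List α
  | _, [] => []
  | s, x :: u => (Q.trans s x).2 ++ output (Q.trans s x).1 u

theorem run_of_accept {s : σ} (h : Q.accept s = true) (u : List α) : Q.run s u = s := by
  induction u with
  | nil => rfl
  | cons x u ih => simp [run, Q.trans_of_accept s x h, ih]

theorem output_of_accept {s : σ} (h : Q.accept s = true) (u : List α) : Q.output s u = [] := by
  induction u with
  | nil => rfl
  | cons x u ih => simp [output, Q.trans_of_accept s x h, ih]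

/-- `u` is the sequence of all letters that ever enter the queue in an accepting computation. -/
def IsHistory (s : σ) (w u : List α) : Prop :=
  u = w ++ Q.output s u ∧ Q.accept (Q.run s u) = true

/-- Deleting the first letter of a history leaves a history of the next configuration, so the length
of `u` bounds the running time. -/
theorem eval_step_dom_of_isHistory {s : σ} {w u : List α} (h : Q.IsHistory s w u) :
    (StateTransition.eval Q.step (s, w)).Dom := by
  induction u generalizing s w with
  | nil =>
    obtain ⟨h, -⟩ := h
    obtain rfl : w = [] := by simpa [output] using h.symm
    exact Part.dom_iff_mem.2 ⟨_, StateTransition.mem_eval.2 ⟨.refl, rfl⟩⟩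
  | cons x u ih =>
    obtain ⟨h, hacc⟩ := h
    cases w with
    | nil => exact Part.dom_iff_mem.2 ⟨_, StateTransition.mem_eval.2 ⟨.refl, rfl⟩⟩
    | cons y w =>
      simp only [output, List.cons_append, List.cons.injEq] at h
      obtain ⟨rfl, h⟩ := h
      by_cases hs : Q.accept s = true
      · exact Part.dom_iff_mem.2 ⟨_, StateTransition.mem_eval.2 ⟨.refl, by simp [step, hs]⟩⟩
      · rw [StateTransition.reaches_eval
          (b := ((Q.trans s x).1, w ++ (Q.trans s x).2)) (.single (by simp [step, hs]))]
        exact ih ⟨by simpa using h, hacc⟩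

theorem exists_isHistory_of_mem_eval {b : σ × List α} {s : σ} {w : List α}
    (h : b ∈ StateTransition.eval Q.step (s, w)) (hb : Q.accept b.1 = true) :
    ∃ u, Q.IsHistory s w u := by
  obtain ⟨h, -⟩ := StateTransition.mem_eval.1 h
  suffices H : ∀ c, StateTransition.Reaches Q.step c b → ∃ u, Q.IsHistory c.1 c.2 u from H _ h
  intro c hc
  induction hc using Relation.ReflTransGen.head_induction_on with
  -- An accepting state reads the remaining queue without output, so that queue is its own history.
  | refl => exact ⟨b.2, by simp [IsHistory, output_of_accept, run_of_accept, hb]⟩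
  | @head c d hcd _ ih =>
    obtain ⟨u, hu, hacc⟩ := ih
    obtain ⟨s, _ | ⟨x, w⟩⟩ := c
    · simp [step] at hcd
    · by_cases hs : Q.accept s = true
      · simp [step, hs] at hcd
      · simp only [step, hs, Bool.false_eq_true, if_false, Option.mem_def, Option.some.injEq] at hcd
        subst hcd
        refine ⟨x :: u, ?_, hacc⟩
        simpa [output] using hu

end QueueMachine

/-! ### Simulation of a Turing machine by a queue machine -/

/-- Letters of a queue that holds a tape: tape cells, the border of the written part of the tape,
and a mark that delimits one rotation of the queue. -/
inductive TapeLetter (Γ : Type)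
  | cell (a : Γ)
  | border
  | mark

instance {Γ : Type} [Finite Γ] : Finite (TapeLetter Γ) :=
  Finite.of_surjective
    (fun x : Option (Option Γ) => x.elim TapeLetter.mark fun y => y.elim .border .cell) fun x => by
      cases x with
      | cell a => exact ⟨some (some a), rfl⟩
      | border => exact ⟨some none, rfl⟩
      | mark => exact ⟨none, rfl⟩

/-- Control states of the simulation of a Turing machine by a queue machine. The state `scan q a`
represents state `q` with `a` under the head; the other states rotate the queue, in state `delay`
with the letter read last being withheld. -/
inductive TapeControl (Γ Λ : Type)
  | scan (q : Λ) (a : Γ)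
  | rotate (q : Λ) (a : Γ)
  | delay (q : Λ) (x : TapeLetter Γ)

instance {Γ Λ : Type} [Finite Γ] [Finite Λ] : Finite (TapeControl Γ Λ) :=
  Finite.of_surjective
    (fun x : (Λ × Γ) ⊕ (Λ × Γ) ⊕ (Λ × TapeLetter Γ) =>
      x.elim (fun y => TapeControl.scan y.1 y.2) fun x =>
        x.elim (fun y => .rotate y.1 y.2) fun y => .delay y.1 y.2) fun x => by
      cases x with
      | scan q a => exact ⟨.inl (q, a), rfl⟩
      | rotate q a => exact ⟨.inr (.inl (q, a)), rfl⟩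
      | delay q x => exact ⟨.inr (.inr (q, x)), rfl⟩

namespace Turing.TM0

open TapeLetter TapeControl

variable {Γ Λ : Type} [Inhabited Γ] [Inhabited Λ] (M : Machine Γ Λ)

/-- The transition function of the queue machine that simulates a Turing machine. -/
def queueTrans : TapeControl Γ Λ → TapeLetter Γ → TapeControl Γ Λ × List (TapeLetter Γ)
  | scan q a, x =>
    match M q a, x with
    | none, _ => (scan q a, [])
    -- Each step consumes a letter, even when only the head cell changes; a full rotation brings `x`
    -- back to the front.
    | some (q', Stmt.write b), x => (rotate q' b, [mark, x])
    | some (q', Stmt.move Dir.right), cell b => (scan q' b, [cell a])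
    | some (q', Stmt.move Dir.right), _ => (rotate q' default, [cell a, mark, border])
    -- The cell to the left of the head is the last letter of the queue. Withholding one letter
    -- during a rotation makes it available when the mark arrives, with `cell a` now first in the
    -- queue.
    | some (q', Stmt.move Dir.left), x => (delay q' x, [mark, cell a])
  | rotate q a, mark => (scan q a, [])
  | rotate q a, x => (rotate q a, [x])
  | delay q (cell a), mark => (scan q a, [])
  -- The withheld letter is the border: the written left part is empty, so the head moves onto a
  -- blank.
  | delay q _, mark => (scan q default, [border])
  | delay q y, x => (delay q x, [y])

/-- The queue machine that simulates a Turing machine; it accepts when the Turing machine halts. -/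
def toQueueMachine : QueueMachine (TapeControl Γ Λ) (TapeLetter Γ) where
  trans := queueTrans M
  accept
    | scan q a => (M q a).isNone
    | _ => false
  trans_of_accept s x h := by
    cases s with
    | scan q a =>
      have h' : M q a = none := by simpa using h
      simp [queueTrans, h']
    | rotate q a => simp at h
    | delay q y => simp at h

/-- The queue that holds the given parts of a tape to the left and to the right of the head. -/
def tapeQueue (L R : List Γ) : List (TapeLetter Γ) :=
  R.map cell ++ border :: (L.reverse.map cell)

theorem mark_notMem_tapeQueue (L R : List Γ) : mark ∉ tapeQueue L R := by
  simp [tapeQueue]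

/-- A configuration of the queue machine represents a configuration of the Turing machine. -/
def Represents (c : Cfg Γ Λ) (d : TapeControl Γ Λ × List (TapeLetter Γ)) : Prop :=
  ∃ L R : List Γ, c.Tape.left = ListBlank.mk L ∧ c.Tape.right = ListBlank.mk R ∧
    d = (scan c.q c.Tape.head, tapeQueue L R)

theorem reaches_rotate (q : Λ) (a : Γ) (u v : List (TapeLetter Γ)) (hu : mark ∉ u) :
    StateTransition.Reaches (toQueueMachine M).step (rotate q a, u ++ mark :: v)
      (scan q a, v ++ u) := by
  induction u generalizing v with
  | nil => exact .single (by simp [QueueMachine.step, toQueueMachine, queueTrans])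
  | cons x u ih =>
    simp only [List.mem_cons, not_or] at hu
    refine .head (b := (rotate q a, u ++ mark :: (v ++ [x]))) ?_ (by simpa [StateTransition.Reaches] using ih (v ++ [x]) hu.2)
    cases x with
    | mark => exact absurd rfl hu.1
    | _ => simp [QueueMachine.step, toQueueMachine, queueTrans]

theorem reaches_delay (q : Λ) (y z : TapeLetter Γ) (u u' v : List (TapeLetter Γ)) (hu : mark ∉ u)
    (h : y :: u = u' ++ [z]) :
    StateTransition.Reaches (toQueueMachine M).step (delay q y, u ++ mark :: v)
      (delay q z, mark :: (v ++ u')) := by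
  induction u generalizing v y u' with
  | nil =>
    cases u' with
    | nil =>
      obtain rfl : y = z := by simpa using h
      rw [List.append_nil]
      exact .refl
    | cons => simp at h
  | cons x u ih =>
    simp only [List.mem_cons, not_or] at hu
    cases u' with
    | nil => simp at h
    | cons y' u' =>
      simp only [List.cons_append, List.cons.injEq] at h
      obtain ⟨rfl, h⟩ := h
      refine .head (b := (delay q x, u ++ mark :: (v ++ [y]))) ?_
        (by simpa [StateTransition.Reaches] using ih x u' (v ++ [y]) hu.2 h)
      cases x with
      | mark => exact absurd rfl hu.1
      | _ => cases y <;> simp [QueueMachine.step, toQueueMachine, queueTrans]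

/-- Only a move to the right within the written part takes a single step; every other move needs one
rotation, given by `reaches_rotate` or `reaches_delay`. Beyond the written part, the blank is
supplied by the control state. -/
theorem toQueueMachine_respects :
    StateTransition.Respects (step M) (toQueueMachine M).step Represents := by
  rintro ⟨q, T⟩ _ ⟨L, R, hL, hR, rfl⟩
  obtain ⟨x, w, hw⟩ := List.exists_cons_of_ne_nil (show tapeQueue L R ≠ [] by simp [tapeQueue])
  have hmark := mark_notMem_tapeQueue L R
  replace hL : T.left = ListBlank.mk L := hL
  replace hR : T.right = ListBlank.mk R := hR
  rcases hM : M q T.head with _ | ⟨q', _ | b⟩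
  · simp [step, hM, QueueMachine.step, toQueueMachine, hw]
  · rename_i d
    cases d with
    | left =>
      simp only [step, hM, Option.map_some]
      have h₁ : ((delay q' x, w ++ mark :: [cell T.head]) :
          TapeControl Γ Λ × List (TapeLetter Γ)) ∈
            (toQueueMachine M).step (scan q T.head, tapeQueue L R) := by
        simp [hw, QueueMachine.step, toQueueMachine, queueTrans, hM]
      have hmw : mark ∉ w := fun h => hmark (hw ▸ List.mem_cons_of_mem _ h)
      cases L with
      | nil =>
        have h₂ := reaches_delay M q' x border w (R.map cell) [cell T.head] hmw
          (by simp [← hw, tapeQueue])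
        refine ⟨_, ⟨[], T.head :: R, by simp [Tape.move, hL], by simp [Tape.move, hR], rfl⟩,
          .head' h₁ (h₂.tail ?_)⟩
        simp [QueueMachine.step, toQueueMachine, queueTrans, Tape.move, hL, tapeQueue]
      | cons l L =>
        have h₂ := reaches_delay M q' x (cell l) w (tapeQueue L R) [cell T.head] hmw
          (by simp [← hw, tapeQueue])
        refine ⟨_, ⟨L, T.head :: R, by simp [Tape.move, hL], by simp [Tape.move, hR], rfl⟩,
          .head' h₁ (h₂.tail ?_)⟩
        simp [QueueMachine.step, toQueueMachine, queueTrans, Tape.move, hL, tapeQueue]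
    | right =>
      simp only [step, hM, Option.map_some]
      cases R with
      | nil =>
        refine ⟨_, ⟨T.head :: L, [], by simp [Tape.move, hL], by simp [Tape.move, hR], rfl⟩,
          .head' (b := (rotate q' default, (L.reverse.map cell ++ [cell T.head]) ++
            mark :: [border])) ?_ ?_⟩
        · simp [QueueMachine.step, toQueueMachine, queueTrans, hM, tapeQueue]
        · have := reaches_rotate M q' default (L.reverse.map cell ++ [cell T.head]) [border]
            (by simp)
          simpa [StateTransition.Reaches, Tape.move, hR, tapeQueue] using this
      | cons r R =>
        refine ⟨_, ⟨T.head :: L, R, by simp [Tape.move, hL], by simp [Tape.move, hR], rfl⟩,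
          .single ?_⟩
        simp [QueueMachine.step, toQueueMachine, queueTrans, hM, tapeQueue, Tape.move, hR]
  · simp only [step, hM, Option.map_some]
    refine ⟨_, ⟨L, R, hL, hR, rfl⟩, .head' (b := (rotate q' b, w ++ mark :: [x])) ?_ ?_⟩
    · simp [hw, QueueMachine.step, toQueueMachine, queueTrans, hM]
    · have := reaches_rotate M q' b w [x] (fun h => hmark (hw ▸ List.mem_cons_of_mem _ h))
      simpa [StateTransition.Reaches, hw, Tape.write] using this

theorem eval_dom_iff_exists_isHistory (a : Γ) (l : List Γ) :
    (eval M (a :: l)).Dom ↔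
      ∃ u, (toQueueMachine M).IsHistory (scan default a) (tapeQueue [] l) u := by
  have hrep : Represents (init (Λ := Λ) (a :: l)) (scan default a, tapeQueue [] l) :=
    ⟨[], l, rfl, rfl, rfl⟩
  constructor
  · intro h
    obtain ⟨b, hb⟩ := Part.dom_iff_mem.1 (show (StateTransition.eval (step M) (init _)).Dom from h)
    obtain ⟨d, ⟨L, R, -, -, rfl⟩, hd⟩ :=
      StateTransition.tr_eval (toQueueMachine_respects M) hrep hb
    refine (toQueueMachine M).exists_isHistory_of_mem_eval hd ?_
    have := (StateTransition.mem_eval.1 hb).2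
    simpa [step, toQueueMachine] using this
  · rintro ⟨u, hu⟩
    exact (StateTransition.tr_eval_dom (toQueueMachine_respects M) hrep).1
      ((toQueueMachine M).eval_step_dom_of_isHistory hu)

end Turing.TM0

/-! ### The deterministic linear automaton of a queue machine -/

namespace QueueMachine

/-- The code of a stack symbol: `none` is the bottom symbol, `some none` the separator. The number
`2` is the code of the end marker, which never enters the stack. -/
def symbolCode {α : Type} [Encodable α] : Option (Option α) → ℕ
  | none => 0
  | some none => 1
  | some (some x) => Encodable.encode x + 3

theorem symbolCode_injective {α : Type} [Encodable α] :
    Function.Injective (symbolCode (α := α)) := by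
  rintro (_ | _ | x) (_ | _ | y) h <;> simp_all [symbolCode]

theorem symbolCode_ne_two {α : Type} [Encodable α] (z : Option (Option α)) :
    symbolCode z ≠ 2 := by
  rcases z with _ | _ | x <;> simp [symbolCode]

/-- The word of the codes of the given letters. -/
def wordCode {α : Type} [Encodable α] (u : List α) : List ℕ :=
  u.map fun x => symbolCode (some (some x))

theorem wordCode_injective {α : Type} [Encodable α] : Function.Injective (wordCode (α := α)) :=
  List.map_injective_iff.2 fun x y h => by simpa using symbolCode_injective h

theorem wordCode_append {α : Type} [Encodable α] (u v : List α) :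
    wordCode (u ++ v) = wordCode u ++ wordCode v :=
  List.map_append

theorem wordCode_reverse {α : Type} [Encodable α] (u : List α) :
    wordCode u.reverse = (wordCode u).reverse :=
  List.map_reverse

theorem three_le_of_mem_wordCode {α : Type} [Encodable α] {u : List α} {n : ℕ}
    (h : n ∈ wordCode u) : 3 ≤ n := by
  obtain ⟨x, -, rfl⟩ := List.mem_map.1 h
  simp [symbolCode]

theorem notMem_wordCode_append_cons {α : Type} [Encodable α] {n : ℕ} (hn : n < 3) (hn' : n ≠ 1)
    (u v : List α) : n ∉ wordCode u ++ 1 :: wordCode v := by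
  intro h
  simp only [List.mem_append, List.mem_cons] at h
  rcases h with h | h | h
  · exact absurd (three_le_of_mem_wordCode h) (by omega)
  · exact hn' h
  · exact absurd (three_le_of_mem_wordCode h) (by omega)

theorem exists_symbolCode_of_mem_wordCode {α : Type} [Encodable α] {u : List α} {n : ℕ}
    (h : n ∈ wordCode u) : ∃ z : Option α, n = symbolCode (some z) := by
  obtain ⟨x, -, rfl⟩ := List.mem_map.1 h
  exact ⟨some x, rfl⟩

/-- The code of the state in which the automaton runs the queue machine. -/
def stateCode {σ : Type} [Encodable σ] (s : σ) : ℕ :=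
  Encodable.encode s + 4

theorem stateCode_inj {σ : Type} [Encodable σ] {s s' : σ} : stateCode s = stateCode s' ↔ s = s' := by
  simp [stateCode]

variable {σ α : Type} [Encodable σ] [Encodable α] (Q : QueueMachine σ α)

/-- The moves of the automaton that do not depend on the initial queue. On the input `u # y $ p $`
the automaton pushes the output of the queue machine on `u`, pushes `#` and `y`, and then compares
the stack with `p`. -/
inductive IsMove : PDAMove → Prop
  | record (s : σ) (x : α) (z : Option (Option α)) :
      IsMove ⟨stateCode s, some (symbolCode (some (some x))), symbolCode z,
        stateCode (Q.trans s x).1, (wordCode (Q.trans s x).2).reverse ++ [symbolCode z]⟩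
  | separate (s : σ) (hs : Q.accept s = true) (z : Option (Option α)) :
      IsMove ⟨stateCode s, some 1, symbolCode z, 1, [1, symbolCode z]⟩
  | copy (x : α) (z : Option (Option α)) :
      IsMove ⟨1, some (symbolCode (some (some x))), symbolCode z, 1,
        [symbolCode (some (some x)), symbolCode z]⟩
  | turn (z : Option (Option α)) : IsMove ⟨1, some 2, symbolCode z, 2, [symbolCode z]⟩
  | compare (z : Option α) :
      IsMove ⟨2, some (symbolCode (some z)), symbolCode (some z), 2, []⟩
  | finish : IsMove ⟨2, some 2, 0, 3, [0]⟩

theorem finite_setOf_isMove [Finite σ] [Finite α] : {t | Q.IsMove t}.Finite := by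
  let f : (σ × α × Option (Option α)) ⊕ (σ × Option (Option α)) ⊕ (α × Option (Option α)) ⊕
      Option (Option α) ⊕ Option α ⊕ Unit → PDAMove := fun i => match i with
    | .inl (s, x, z) => ⟨stateCode s, some (symbolCode (some (some x))), symbolCode z,
        stateCode (Q.trans s x).1, (wordCode (Q.trans s x).2).reverse ++ [symbolCode z]⟩
    | .inr (.inl (s, z)) => ⟨stateCode s, some 1, symbolCode z, 1, [1, symbolCode z]⟩
    | .inr (.inr (.inl (x, z))) => ⟨1, some (symbolCode (some (some x))), symbolCode z, 1,
        [symbolCode (some (some x)), symbolCode z]⟩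
    | .inr (.inr (.inr (.inl z))) => ⟨1, some 2, symbolCode z, 2, [symbolCode z]⟩
    | .inr (.inr (.inr (.inr (.inl z)))) =>
        ⟨2, some (symbolCode (some z)), symbolCode (some z), 2, []⟩
    | .inr (.inr (.inr (.inr (.inr ())))) => ⟨2, some 2, 0, 3, [0]⟩
  refine (Set.finite_range f).subset ?_
  rintro t (⟨s, x, z⟩ | ⟨s, -, z⟩ | ⟨x, z⟩ | z | z | _)
  · exact ⟨.inl (s, x, z), rfl⟩
  · exact ⟨.inr (.inl (s, z)), rfl⟩
  · exact ⟨.inr (.inr (.inl (x, z))), rfl⟩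
  · exact ⟨.inr (.inr (.inr (.inl z))), rfl⟩
  · exact ⟨.inr (.inr (.inr (.inr (.inl z)))), rfl⟩
  · exact ⟨.inr (.inr (.inr (.inr (.inr ())))), rfl⟩

variable [Finite σ] [Finite α]

/-- The pushdown automaton for a queue machine with initial state `s₀` and initial queue `w`. -/
noncomputable def toPDA (s₀ : σ) (w : List α) : PDA where
  start := 0
  bottom := 0
  final := [3]
  moves := ⟨0, none, 0, stateCode s₀, (wordCode w).reverse ++ [0]⟩ ::
    Q.finite_setOf_isMove.toFinset.toList

theorem mem_moves_toPDA {s₀ : σ} {w : List α} {t : PDAMove} : t ∈ (Q.toPDA s₀ w).moves ↔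
    t = ⟨0, none, 0, stateCode s₀, (wordCode w).reverse ++ [0]⟩ ∨ Q.IsMove t := by
  simp [toPDA]

/-- The only `ε`-move leaves state `0`, which has no other moves. Elsewhere the state and the letter
fix the kind of move, because letters of the queue, `#` and `$` have distinct codes. -/
theorem isDeterministic_toPDA (s₀ : σ) (w : List α) : (Q.toPDA s₀ w).IsDeterministic := by
  intro t₁ h₁ t₂ h₂ hs ht hl
  rw [mem_moves_toPDA] at h₁ h₂
  have hne : ∀ x : α, symbolCode (some (some x)) ≠ 1 := fun x => by simp [symbolCode]
  have hne' := symbolCode_ne_two (α := α)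
  rcases h₁ with rfl | h₁ <;> rcases h₂ with rfl | h₂
  · rfl
  · cases h₂ <;> simp [stateCode] at hs
  · cases h₁ <;> simp [stateCode] at hs
  · cases h₁ <;> cases h₂ <;> try (exfalso; simp [stateCode] at hs; done)
    all_goals
      simp only [reduceCtorEq, false_or, Option.some.injEq, symbolCode_injective.eq_iff,
        stateCode_inj] at hs ht hl
    all_goals first
      | (subst_vars; rfl)
      | exact absurd hl (hne _)
      | exact absurd hl.symm (hne _)
      | exact absurd hl (hne' _)
      | exact absurd hl.symm (hne' _)

/-- A move that pops leads into state `2`; the states `2` and `3` are never left for others, and no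
move from them raises the stack. -/
theorem isLinear_toPDA (s₀ : σ) (w : List α) : (Q.toPDA s₀ w).IsLinear := by
  intro v c₁ c₂ c₃ c₄ _ h₁₂ hlt h₂₃ h₃₄
  have hlow : ∀ t ∈ (Q.toPDA s₀ w).moves, (t.source = 2 ∨ t.source = 3) →
      (t.target = 2 ∨ t.target = 3) ∧ t.push.length ≤ 1 := by
    intro t ht hs
    rcases Q.mem_moves_toPDA.1 ht with rfl | h
    · simp at hs
    · cases h <;> simp_all [stateCode]
  have hhigh : ∀ t ∈ (Q.toPDA s₀ w).moves, t.push.length < 1 → t.target = 2 ∨ t.target = 3 := by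
    intro t ht hs
    rcases Q.mem_moves_toPDA.1 ht with rfl | h
    · simp at hs
    · cases h <;> simp_all
  have h₂ : c₂.state = 2 ∨ c₂.state = 3 := by
    obtain ⟨t, ht, u, s⟩ := h₁₂
    exact hhigh t ht (by
      simp only [List.length_append, List.length_cons] at hlt
      omega)
  have h₃ : c₃.state = 2 ∨ c₃.state = 3 := by
    clear h₃₄
    induction h₂₃ with
    | refl => exact h₂
    | tail _ hstep ih =>
      obtain ⟨t, ht, u, s⟩ := hstep
      exact (hlow t ht ih).1
  obtain ⟨t, ht, u, s⟩ := h₃₄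
  have := (hlow t ht h₃).2
  simp only [List.length_append, List.length_cons]
  omega

/-- The content of the stack, above the bottom symbol, when the part `u # y` of the input has been
read. -/
def stackWord (s₀ : σ) (w u y : List α) : List ℕ :=
  wordCode y.reverse ++ 1 :: wordCode (w ++ Q.output s₀ u).reverse

/-- The configurations that are reachable on the input `v`. -/
inductive Invariant (s₀ : σ) (w : List α) (v : List ℕ) : PDAConfig → Prop
  | start : Invariant s₀ w v ⟨0, v, [0]⟩
  | record (u : List α) (r stk : List ℕ) (q : ℕ) (hq : q = stateCode (Q.run s₀ u))
      (hv : v = wordCode u ++ r) (hs : stk = wordCode (w ++ Q.output s₀ u).reverse ++ [0]) :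
      Invariant s₀ w v ⟨q, r, stk⟩
  | copy (u y : List α) (r stk : List ℕ) (hu : Q.accept (Q.run s₀ u) = true)
      (hv : v = wordCode u ++ 1 :: (wordCode y ++ r)) (hs : stk = Q.stackWord s₀ w u y ++ [0]) :
      Invariant s₀ w v ⟨1, r, stk⟩
  | compare (u y : List α) (p r stk : List ℕ) (hu : Q.accept (Q.run s₀ u) = true)
      (hv : v = wordCode u ++ 1 :: (wordCode y ++ 2 :: (p ++ r)))
      (hs : p ++ stk = Q.stackWord s₀ w u y ++ [0]) :
      Invariant s₀ w v ⟨2, r, stk⟩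
  | finish (u y : List α) (r stk : List ℕ) (hu : Q.accept (Q.run s₀ u) = true)
      (hv : v = wordCode u ++ 1 :: (wordCode y ++ 2 :: (Q.stackWord s₀ w u y ++ 2 :: r))) :
      Invariant s₀ w v ⟨3, r, stk⟩

omit [Encodable σ] [Encodable α] [Finite σ] [Finite α] in
theorem run_append_singleton (s : σ) (u : List α) (x : α) :
    Q.run s (u ++ [x]) = (Q.trans (Q.run s u) x).1 := by
  induction u generalizing s with
  | nil => rfl
  | cons y u ih => exact ih _

omit [Encodable σ] [Encodable α] [Finite σ] [Finite α] in
theorem output_append_singleton (s : σ) (u : List α) (x : α) :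
    Q.output s (u ++ [x]) = Q.output s u ++ (Q.trans (Q.run s u) x).2 := by
  induction u generalizing s with
  | nil => simp [output, run]
  | cons y u ih => simp [output, run, ih]

theorem invariant_step {s₀ : σ} {w : List α} {v : List ℕ} {c d : PDAConfig}
    (hc : Q.Invariant s₀ w v c) (h : (Q.toPDA s₀ w).Step c d) : Q.Invariant s₀ w v d := by
  obtain ⟨t, ht, r, stk⟩ := h
  generalize hc' : (⟨t.source, t.label.toList ++ r, t.top :: stk⟩ : PDAConfig) = c at hc
  rcases Q.mem_moves_toPDA.1 ht with rfl | ht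
  · cases hc with
    | start =>
      simp only [Option.toList_none, List.nil_append, PDAConfig.mk.injEq, List.cons.injEq,
        true_and] at hc'
      obtain ⟨rfl, rfl⟩ := hc'
      exact .record [] _ _ _ rfl rfl (by simp [output, wordCode_reverse])
    | record => simp_all [stateCode]
    | _ => simp at hc'
  · cases ht with
    | record s x z =>
      cases hc with
      | record u r' stk' q hq hv hs =>
        simp only [Option.toList_some, List.cons_append, List.nil_append, PDAConfig.mk.injEq]
          at hc'
        obtain ⟨rfl, rfl, rfl⟩ := hc'
        obtain rfl := stateCode_inj.1 hq
        refine .record (u ++ [x]) _ _ _ (by rw [run_append_singleton]) ?_ ?_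
        · simp [hv, wordCode]
        · simp [hs, output_append_singleton, wordCode_append, wordCode_reverse]
      | _ => simp [stateCode] at hc'
    | separate s hs z =>
      cases hc with
      | record u r' stk' q hq hv hs' =>
        simp only [Option.toList_some, List.cons_append, List.nil_append, PDAConfig.mk.injEq]
          at hc'
        obtain ⟨rfl, rfl, rfl⟩ := hc'
        obtain rfl := stateCode_inj.1 hq
        refine .copy u [] _ _ hs (by simpa [wordCode] using hv) ?_
        simp [hs', stackWord, wordCode]
      | _ => simp [stateCode] at hc'
    | copy x z =>
      cases hc with
      | copy u y r' stk' hu hv hs =>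
        simp only [Option.toList_some, List.cons_append, List.nil_append, PDAConfig.mk.injEq,
          true_and] at hc'
        obtain ⟨rfl, rfl⟩ := hc'
        refine .copy u (y ++ [x]) _ _ hu (by simpa [wordCode] using hv) ?_
        simp [hs, stackWord, wordCode]
      | record u r' stk' q hq => simp [hq, stateCode] at hc'
      | _ => simp at hc'
    | turn z =>
      cases hc with
      | copy u y r' stk' hu hv hs =>
        simp only [Option.toList_some, List.cons_append, List.nil_append, PDAConfig.mk.injEq,
          true_and] at hc'
        obtain ⟨rfl, rfl⟩ := hc'
        exact .compare u y [] _ _ hu (by simpa using hv) (by simpa using hs)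
      | record u r' stk' q hq => simp [hq, stateCode] at hc'
      | _ => simp at hc'
    | compare z =>
      cases hc with
      | compare u y p r' stk' hu hv hs =>
        simp only [Option.toList_some, List.cons_append, List.nil_append, PDAConfig.mk.injEq,
          true_and] at hc'
        obtain ⟨rfl, rfl⟩ := hc'
        refine .compare u y (p ++ [symbolCode (some z)]) _ _ hu
          (by simpa using hv) (by simpa using hs)
      | record u r' stk' q hq => simp [hq, stateCode] at hc'
      | _ => simp at hc'
    | finish =>
      cases hc with
      | compare u y p r' stk' hu hv hs =>
        simp only [Option.toList_some, List.cons_append, List.nil_append, PDAConfig.mk.injEq,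
          true_and] at hc'
        obtain ⟨rfl, rfl⟩ := hc'
        -- The bottom symbol `0` does not occur in the stack word, so reaching it means that the
        -- whole stack word has been compared.
        obtain ⟨rfl, -, -⟩ := (List.append_cons_inj_of_notMem
          (notMem_wordCode_append_cons (by omega) (by omega) _ _) List.not_mem_nil).1 hs.symm
        exact .finish u y _ _ hu hv
      | record u r' stk' q hq => simp [hq, stateCode] at hc'
      | _ => simp at hc'

/-- By the invariant, an accepted input has the form `z $ p $` with `z = u # y` and `p` the stack
word. For a square, `z = p`, and splitting both sides at their only `#` yields the fixed-point
equation. -/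
theorem exists_isHistory_of_mem_language {s₀ : σ} {w : List α} {x : List ℕ}
    (h : x ++ x ∈ (Q.toPDA s₀ w).language) : ∃ u, Q.IsHistory s₀ w u := by
  obtain ⟨q, hq, stk, hreach⟩ := h
  obtain rfl : q = 3 := by simpa [toPDA] using hq
  have hinv : ∀ c, (Q.toPDA s₀ w).Reaches ((Q.toPDA s₀ w).init (x ++ x)) c →
      Q.Invariant s₀ w (x ++ x) c := by
    intro c hc
    induction hc with
    | refl => exact .start
    | tail _ hstep ih => exact Q.invariant_step ih hstep
  generalize hd : (⟨3, [], stk⟩ : PDAConfig) = d at hreach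
  cases hinv d hreach with
  | record u r' stk' q hq => simp [hq, stateCode] at hd
  | finish u y r stk' hu hv =>
    simp only [PDAConfig.mk.injEq, true_and] at hd
    obtain ⟨rfl, rfl⟩ := hd
    set p := Q.stackWord s₀ w u y with hp
    set z := wordCode u ++ 1 :: wordCode y with hz
    have h2p : 2 ∉ p := notMem_wordCode_append_cons (by omega) (by omega) _ _
    have h2z : 2 ∉ z := notMem_wordCode_append_cons (by omega) (by omega) _ _
    have hv' : x ++ x = (z ++ 2 :: p) ++ [2] := by simp [hv, hz]
    obtain rfl | ⟨x, b, rfl⟩ := List.eq_nil_or_concat' x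
    · simp at hv'
    obtain ⟨hxx, hb⟩ := List.append_inj' (s₁ := (x ++ [b]) ++ x) (t₁ := [b])
      (s₂ := z ++ 2 :: p) (t₂ := [2]) (by simpa using hv') rfl
    obtain rfl : b = 2 := by simpa using hb
    -- With the final `$` removed from both sides, `x $ x = z $ p`. Counting `$` shows that `x`
    -- contains none, so the two sides split at the same place.
    have hcount := congrArg (List.count 2) hxx
    simp only [List.count_append, List.count_cons_self, List.count_nil, List.count_eq_zero.2 h2p,
      List.count_eq_zero.2 h2z] at hcount
    have h2x : 2 ∉ x := List.count_eq_zero.1 (by omega)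
    obtain ⟨rfl, -, hxp⟩ := (List.append_cons_inj_of_notMem h2x h2x).1
      (show x ++ 2 :: x = z ++ 2 :: p by simpa using hxx)
    obtain ⟨huy, -, hyw⟩ := (List.append_cons_inj_of_notMem (a₁ := 1) (a₂ := 1)
      (fun h => absurd (three_le_of_mem_wordCode h) (by omega))
      (fun h => absurd (three_le_of_mem_wordCode h) (by omega))).1 (hz.symm.trans hxp)
    have huy := wordCode_injective huy
    have hyw := wordCode_injective hyw
    exact ⟨u, by rw [huy]; conv_lhs => rw [hyw]
                 rw [List.reverse_reverse, huy], hu⟩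
  | _ => simp at hd

/-- The finitely many moves cover only tops that are codes of stack symbols; `hstk` is this
condition, and it is preserved by each push. -/
theorem reaches_record (s₀ : σ) (w : List α) (s : σ) (u : List α) (r stk : List ℕ)
    (hstk : ∃ (z : Option (Option α)) (stk' : List ℕ), stk = symbolCode z :: stk') :
    (Q.toPDA s₀ w).Reaches ⟨stateCode s, wordCode u ++ r, stk⟩
      ⟨stateCode (Q.run s u), r, wordCode (Q.output s u).reverse ++ stk⟩ := by
  induction u generalizing s stk with
  | nil => exact .refl
  | cons x u ih =>
    obtain ⟨z, stk, rfl⟩ := hstk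
    refine .head (.move _ (Q.mem_moves_toPDA.2 (.inr (.record s x z))) (wordCode u ++ r) stk) ?_
    have h := ih (Q.trans s x).1 ((wordCode (Q.trans s x).2).reverse ++ symbolCode z :: stk) (by
      rw [← wordCode_reverse]
      cases (Q.trans s x).2.reverse with
      | nil => exact ⟨z, stk, rfl⟩
      | cons y l => exact ⟨some (some y), _, rfl⟩)
    simpa [PDA.Reaches, run, output, wordCode_append, wordCode_reverse] using h

theorem reaches_copy (s₀ : σ) (w : List α) (y : List α) (r stk : List ℕ)
    (hstk : ∃ (z : Option (Option α)) (stk' : List ℕ), stk = symbolCode z :: stk') :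
    (Q.toPDA s₀ w).Reaches ⟨1, wordCode y ++ r, stk⟩ ⟨1, r, wordCode y.reverse ++ stk⟩ := by
  induction y generalizing stk with
  | nil => exact .refl
  | cons x y ih =>
    obtain ⟨z, stk, rfl⟩ := hstk
    refine .head (.move _ (Q.mem_moves_toPDA.2 (.inr (.copy x z))) (wordCode y ++ r) stk) ?_
    simpa [PDA.Reaches, wordCode] using
      ih (symbolCode (some (some x)) :: symbolCode z :: stk) ⟨_, _, rfl⟩

theorem reaches_compare (s₀ : σ) (w : List α) (p r stk : List ℕ)
    (hp : ∀ n ∈ p, ∃ z : Option α, n = symbolCode (some z)) :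
    (Q.toPDA s₀ w).Reaches ⟨2, p ++ r, p ++ stk⟩ ⟨2, r, stk⟩ := by
  induction p with
  | nil => exact .refl
  | cons n p ih =>
    obtain ⟨z, rfl⟩ := hp n (by simp)
    exact .head (.move _ (Q.mem_moves_toPDA.2 (.inr (.compare z))) (p ++ r) (p ++ stk))
      (ih fun m hm => hp m (by simp [hm]))

/-- Taking `y = uᴿ` and using `w ++ output u = u`, the stack word `yᴿ # (w ++ output u)ᴿ` becomes `u
# uᴿ`, the very word read before the first `$`. -/
theorem mem_language_of_isHistory {s₀ : σ} {w u : List α} (h : Q.IsHistory s₀ w u) :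
    (wordCode u ++ 1 :: wordCode u.reverse ++ [2]) ++ (wordCode u ++ 1 :: wordCode u.reverse ++ [2])
      ∈ (Q.toPDA s₀ w).language := by
  obtain ⟨hu, hacc⟩ := h
  refine ⟨3, by simp [toPDA], [0], ?_⟩
  set p := wordCode u ++ 1 :: wordCode u.reverse with hp
  have hpz : ∀ n ∈ p, ∃ z : Option α, n = symbolCode (some z) := by
    intro n hn
    simp only [hp, List.mem_append, List.mem_cons] at hn
    rcases hn with hn | rfl | hn
    · exact exists_symbolCode_of_mem_wordCode hn
    · exact ⟨none, rfl⟩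
    · exact exists_symbolCode_of_mem_wordCode hn
  have htop : ∀ v : List α, ∃ z stk', wordCode v ++ [0] = symbolCode (z : Option (Option α)) :: stk' :=
    fun v => by
      cases v with
      | nil => exact ⟨none, [], rfl⟩
      | cons x v => exact ⟨some (some x), _, rfl⟩
  have h₁ : (Q.toPDA s₀ w).Reaches ((Q.toPDA s₀ w).init ((p ++ [2]) ++ (p ++ [2])))
      ⟨stateCode s₀, (p ++ [2]) ++ (p ++ [2]), wordCode w.reverse ++ [0]⟩ := by
    have := PDA.Step.move (M := Q.toPDA s₀ w) _ (Q.mem_moves_toPDA.2 (.inl rfl))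
      ((p ++ [2]) ++ (p ++ [2])) []
    simp only [List.append_nil] at this
    rw [wordCode_reverse]
    exact .single this
  have h₂ := Q.reaches_record s₀ w s₀ u (1 :: (wordCode u.reverse ++ 2 :: (p ++ [2])))
    (wordCode w.reverse ++ [0]) (htop _)
  have hst : wordCode (Q.output s₀ u).reverse ++ (wordCode w.reverse ++ [0]) =
      wordCode u.reverse ++ [0] := by
    conv_rhs => rw [hu]
    simp [wordCode_append]
  rw [hst] at h₂
  have h₃ : (Q.toPDA s₀ w).Step
      ⟨stateCode (Q.run s₀ u), 1 :: (wordCode u.reverse ++ 2 :: (p ++ [2])),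
        wordCode u.reverse ++ [0]⟩
      ⟨1, wordCode u.reverse ++ 2 :: (p ++ [2]), 1 :: (wordCode u.reverse ++ [0])⟩ := by
    obtain ⟨z, stk', hz⟩ := htop u.reverse
    rw [hz]
    exact .move _ (Q.mem_moves_toPDA.2 (.inr (.separate _ hacc z))) _ stk'
  have h₄ := Q.reaches_copy s₀ w u.reverse (2 :: (p ++ [2])) (1 :: (wordCode u.reverse ++ [0]))
    ⟨some none, _, rfl⟩
  have hst' : wordCode u.reverse.reverse ++ 1 :: (wordCode u.reverse ++ [0]) = p ++ [0] := by
    simp [hp]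
  rw [hst'] at h₄
  have h₅ : (Q.toPDA s₀ w).Step ⟨1, 2 :: (p ++ [2]), p ++ [0]⟩ ⟨2, p ++ [2], p ++ [0]⟩ := by
    obtain ⟨n, l, hl⟩ := List.exists_cons_of_ne_nil (show p ≠ [] by simp [hp])
    obtain ⟨z, rfl⟩ := hpz n (by simp [hl])
    have := PDA.Step.move (M := Q.toPDA s₀ w) _ (Q.mem_moves_toPDA.2 (.inr (.turn (some z))))
      (p ++ [2]) (l ++ [0])
    simpa [hl] using this
  have h₆ := Q.reaches_compare s₀ w p [2] [0] hpz
  have h₇ : (Q.toPDA s₀ w).Step ⟨2, [2], [0]⟩ ⟨3, [], [0]⟩ :=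
    .move _ (Q.mem_moves_toPDA.2 (.inr .finish)) [] []
  have hin : (p ++ [2]) ++ (p ++ [2]) =
      wordCode u ++ 1 :: (wordCode u.reverse ++ 2 :: (p ++ [2])) := by
    simp [hp]
  rw [hin] at h₁ ⊢
  exact (h₁.trans h₂).trans (.head h₃ (h₄.trans (.head h₅ (h₆.tail h₇))))

end QueueMachine

/-! ### Computability of the reduction, and the theorem -/

namespace QueueMachine

variable {σ α : Type} [Encodable σ] [Encodable α] [Finite σ] [Finite α]

/-- The automaton is computable from the initial queue. -/
theorem computable_toPDA (Q : QueueMachine σ α) (s₀ : σ) {w : ℕ → List α}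
    (hw : Primrec fun k => wordCode (w k).reverse) : Computable fun k => Q.toPDA s₀ (w k) := by
  have hmove : Primrec fun k =>
      (⟨0, none, 0, stateCode s₀, (wordCode (w k)).reverse ++ [0]⟩ : PDAMove) := by
    refine (Primrec.of_equiv_symm (e := PDAMove.equivProd)).comp (Primrec.pair (.const 0)
      (Primrec.pair (.const none) (Primrec.pair (.const 0) (Primrec.pair (.const (stateCode s₀))
        (Primrec.list_append.comp ?_ (.const [0]))))))
    simpa only [wordCode_reverse] using hw
  -- Only the first move depends on `k`. The others form a fixed finite list, so it is harmless that
  -- this list is obtained noncomputably.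
  exact ((Primrec.of_equiv_symm (e := PDA.equivProd)).comp (Primrec.pair (.const 0)
    (Primrec.pair (.const 0) (Primrec.pair (.const [3])
      (Primrec.list_cons.comp hmove (.const Q.finite_setOf_isMove.toFinset.toList)))))).to_comp

end QueueMachine

theorem Primrec.list_replicate {β : Type} [Primcodable β] (b : β) :
    Primrec fun k : ℕ => List.replicate k b :=
  (Primrec.nat_rec₁ [] (Primrec.list_cons.comp (.const b) Primrec.snd).to₂).of_eq fun k => by
    induction k with
    | zero => rfl
    | succ k ih => simp_all [List.replicate_succ]

theorem theorem4p1 :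
    ¬ ∃ f : PDA →. Bool, Partrec f ∧
      ∀ M : PDA, M.IsDeterministic → M.IsLinear →
        ∃ b ∈ f M, (b = true ↔ ∃ w : List ℕ, w ++ w ∈ M.language) := by
  rintro ⟨f, hf, hdec⟩
  obtain ⟨Γ, Λ, _, _, _, _, T, a, b, c, hund⟩ := exists_finite_TM0_not_computablePred
  -- The machine `T` is fixed, so arbitrary encodings of its finite alphabets suffice.
  have : Encodable (TapeLetter Γ) := Classical.choice (nonempty_encodable _)
  have : Encodable (TapeControl Γ Λ) := Classical.choice (nonempty_encodable _)
  let Q := Turing.TM0.toQueueMachine T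
  let s₀ : TapeControl Γ Λ := .scan default a
  let w (k : ℕ) : List (TapeLetter Γ) := Turing.TM0.tapeQueue [] (b :: List.replicate k c)
  have hhalt (k : ℕ) : (Turing.TM0.eval T (a :: b :: List.replicate k c)).Dom ↔
      ∃ x : List ℕ, x ++ x ∈ (Q.toPDA s₀ (w k)).language := by
    rw [Turing.TM0.eval_dom_iff_exists_isHistory]
    exact ⟨fun ⟨u, hu⟩ => ⟨_, Q.mem_language_of_isHistory hu⟩,
      fun ⟨x, hx⟩ => Q.exists_isHistory_of_mem_language hx⟩
  have hw : Primrec fun k => QueueMachine.wordCode (w k).reverse := by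
    refine (Primrec.list_append.comp (Primrec.list_cons.comp
      (.const (QueueMachine.symbolCode (some (some (TapeLetter.border : TapeLetter Γ)))))
      (Primrec.list_replicate (QueueMachine.symbolCode (some (some (TapeLetter.cell c))))))
      (.const [QueueMachine.symbolCode (some (some (TapeLetter.cell b)))])).of_eq fun k => ?_
    simp [w, Turing.TM0.tapeQueue, QueueMachine.wordCode]
  classical
  refine hund (ComputablePred.computable_iff.2
    ⟨fun k => decide (Turing.TM0.eval T (a :: b :: List.replicate k c)).Dom, ?_, by simp⟩)
  -- Every automaton in the range of the reduction is deterministic and linear, so the partial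
  -- function `f` is defined and correct on it, and the composite is a total decision procedure for
  -- halting.
  refine (hf.comp (Q.computable_toPDA s₀ hw)).of_eq fun k => ?_
  obtain ⟨d, hd, hd'⟩ := hdec (Q.toPDA s₀ (w k)) (Q.isDeterministic_toPDA s₀ (w k))
    (Q.isLinear_toPDA s₀ (w k))
  rw [Part.eq_some_iff.2 hd]
  refine congrArg Part.some (Bool.eq_iff_iff.2 ?_)
  rw [hd', ← hhalt k, decide_eq_true_iff]
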